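/- Let $p$ be an odd prime number, $K$ a field of characteristic $p$ and $q \in \{1,\dots,p-1\}$. For $f \in K[[z]]$ with $f(0)=0$ let $\operatorname{mult}(f)$ be the lowest degree of a nonzero term of $f(z)-z$ (it is $+\infty$ if $f(z)=z$). If $f(z)\ne z$, let $\operatorname{ind}(f)$ be the coefficient of $1/z$ in the Laurent series $1/(z-f(z))$, and put $\operatorname{resit}(f)=\tfrac12\operatorname{mult}(f)-\operatorname{ind}(f)$. If $\operatorname{mult}(f)\ge 2$, put $i_n(f)=\operatorname{mult}(f^{p^n})-1$, where $f^{p^n}$ is the $p^n$-th iterate of $f$ under composition; $f$ is called $q$-ramified if $i_n(f)=q(1+p+\cdots+p^n)$ for every $n\ge 0$. Let $\mathcal N_q(K)$ be the set of power series $f$ with $f(0)=0$ and $\operatorname{mult}(f)\ge q+1$, and let $$P=\frac{q+1}{2}\,x_q^{q+1}+\sum_{\iota}(-1)^{q-\iota_0}\binom{q-\iota_0}{\iota_1,\dots,\iota_q}\prod_{j=0}^q x_{q+j}^{\iota_j}\ \in\ \mathbb F_p[x_q,\dots,x_{2q}],$$ where the sum is over $\iota=(\iota_0,\dots,\iota_q)\in\mathbb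 N^{q+1}$ with $\sum_{j=0}^q\iota_j=q$ and $\sum_{j=1}^q j\iota_j=q$. Let $T$ be either $\mathcal N_q(K)$ or its subset $\{f:\operatorname{mult}(f)=q+1\}$, and write its elements as $f(z)=z\bigl(1+\sum_{j\ge q}a_jz^j\bigr)$. A subset $S$ of $T$ is called generic in $T$ if there is a nonzero polynomial $Q\in K[x_q,x_{q+1},\dots]$ such that $Q(a_q,a_{q+1},\dots)\neq0$ for some $f\in T$, and such that every $f\in T$ with $Q(a_q,a_{q+1},\dots)\ne0$ belongs to $S$. Then the following hold. 1. $P$ is nonzero, and it is isobaric of degree $q(q+1)$ when each $x_j$ has weight $j$. 2. For every $f(z)=z\bigl(1+\sum_{j\ge q}a_jz^j\bigr)\in K[[z]]$ with $\operatorname{mult}(f)=q+1$ we have $a_q^{q+1}\operatorname{resit}(f)=P(a_q,\dots,a_{2q})$. Moreover, $f$ is $q$-ramified if and only if $P(a_q,\dots,a_{2q})\neq0$, and if and only if $\operatorname{resit}(f)\ne0$. 3. The $q$-ramified series are generic in $\{f:\operatorname{mult}(f)=q+1\}$. 4. An element $f$ of $\mathcal N_q(K)$ is $q$-ramified if and only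 if $\operatorname{mult}(f)=q+1$ and $\operatorname{resit}(f)\neq0$. The $q$-ramified series are generic in $\mathcal N_q(K)$. -/

import Mathlib

namespace WildSeries

noncomputable section

open PowerSeries

/-- The multiplicity of `0` as a fixed point of `f`: the lowest degree of a nonzero term of
`f(z) - z`, with value `⊤` exactly when `f(z) = z`.
It is at least `1` exactly when `f(0) = 0`. -/
def mult {K : Type*} [Field K] (f : K⟦X⟧) : ℕ∞ := (f - X).order

/-- `f` is wildly ramified: `f(0) = 0` and `0` is a multiple fixed point of `f`. -/
def IsWildlyRamified {K : Type*} [Field K] (f : K⟦X⟧) : Prop := 2 ≤ mult f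

/-- The `n`-th iterate `f ∘ ⋯ ∘ f` (for `f` with `f(0) = 0`); `subst g f` is `f(g(z))`. -/
def iter {K : Type*} [Field K] (f : K⟦X⟧) (n : ℕ) : K⟦X⟧ :=
  (fun g : K⟦X⟧ => PowerSeries.subst g f)^[n] X

/-- The lower ramification number `i_n(f) = mult (f^{p^n}) - 1`. -/
def lowerRamificationNumber {K : Type*} [Field K] (p : ℕ) (f : K⟦X⟧) (n : ℕ) : ℕ∞ :=
  mult (iter f (p ^ n)) - 1

/-- `f` is `q`-ramified: it is wildly ramified and `i_n(f) = q (1 + p + ⋯ + p ^ n)` for every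
`n ≥ 0`. (For `n = 0` this says `mult f = q + 1`.) -/
def IsQRamified {K : Type*} [Field K] (p q : ℕ) (f : K⟦X⟧) : Prop :=
  IsWildlyRamified f ∧
    ∀ n : ℕ, lowerRamificationNumber p f n = ((q * ∑ i ∈ Finset.range (n + 1), p ^ i : ℕ) : ℕ∞)

/-- The residue fixed point index: the coefficient of `1/z` in the Laurent series
`1 / (z - f(z))` (for `f(z) ≠ z`). -/
def ind {K : Type*} [Field K] (f : K⟦X⟧) : K :=
  (((X - f : K⟦X⟧) : LaurentSeries K)⁻¹).coeff (-1)

/-- The iterative residue `mult(f) / 2 - ind(f)` (for `f(z) ≠ z` and characteristic not `2`). -/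
def resit {K : Type*} [Field K] (f : K⟦X⟧) : K :=
  (1 / 2 : K) * ((mult f).toNat : K) - ind f

/-- The subgroup `N_q(K)` of the Nottingham group, as a set of power series. -/
def nottingham (K : Type*) [Field K] (q : ℕ) : Set K⟦X⟧ := {f | ((q + 1 : ℕ) : ℕ∞) ≤ mult f}

/-- The coordinates of `f`: writing `f(z) = z (1 + ∑_{j ≥ q} x_j z ^ j)`, this is the sequence
`x_q, x_{q + 1}, x_{q + 2}, …`, indexed from `0`. -/
def coords {K : Type*} [Field K] (q : ℕ) (f : K⟦X⟧) (j : ℕ) : K := coeff (q + j + 1) f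

/-- The polynomial
`((q + 1) / 2) x_q ^ (q + 1) + ∑_ι (-1) ^ (q - ι_0) (q - ι_0; ι_1, …, ι_q) ∏_j x_{q + j} ^ ι_j`
over `𝔽_p`, the sum being over `ι ∈ ℕ ^ (q + 1)` with `∑_j ι_j = q` and `∑_j j ι_j = q`.
The variable with index `j : Fin (q + 1)` stands for `x_{q + j}`. -/
def genericityPolynomial (p q : ℕ) [Fact p.Prime] : MvPolynomial (Fin (q + 1)) (ZMod p) :=
  MvPolynomial.C (((q : ZMod p) + 1) / 2) * MvPolynomial.X 0 ^ (q + 1) +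
    ∑ ι ∈ (Finset.piAntidiag (Finset.univ : Finset (Fin (q + 1))) q).filter
        (fun ι => ∑ j : Fin (q + 1), (j : ℕ) * ι j = q),
      MvPolynomial.C ((-1 : ZMod p) ^ (q - ι 0) *
          (Nat.multinomial (Finset.univ.erase (0 : Fin (q + 1))) ι : ZMod p)) *
        ∏ j : Fin (q + 1), MvPolynomial.X j ^ ι j

/-- The value of the genericity polynomial at the coefficients `x_q, …, x_{2q}` of `f`. -/
def genericityValue {K : Type*} [Field K] (p q : ℕ) [Fact p.Prime] [CharP K p] (f : K⟦X⟧) : K :=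
  (genericityPolynomial p q).eval₂ (ZMod.castHom (dvd_refl p) K)
    (fun j : Fin (q + 1) => coords q f j)

/-- Genericity in the Zariski sense. Here `T` is a set of power series
`z (1 + ∑_{j ≥ q} x_j z ^ j)`, given in the coordinates `x_q, x_{q + 1}, …` by a nonempty Zariski
open condition (such as no condition, or `x_q ≠ 0`). The set `S` is generic in `T` if it contains
all points of `T` where some nonzero polynomial in the coordinates does not vanish. It is moreover
required that there be such a point (which is automatic when `K` is infinite), so that the
notion is not void over a finite field. -/
def IsGeneric {K : Type*} [Field K] (q : ℕ) (T S : Set K⟦X⟧) : Prop :=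
  ∃ P : MvPolynomial ℕ K, P ≠ 0 ∧ (∃ f ∈ T, P.eval (coords q f) ≠ 0) ∧
    ∀ f ∈ T, P.eval (coords q f) ≠ 0 → f ∈ S

end

end WildSeries

/-! Let `T` be the substitution `u ↦ u ∘ f` and `D = T - 1`. In characteristic `p` one has `T ^ p -
1 = D ^ p`, so the iterates `f^{p^n}` can be studied through repeated differences. If `f = X + a
X^{m+1} + ⋯`, then `D` sends `X^e` to `e a X^{e+m} + ⋯`, which loses the leading term as soon as `p
∣ e`.

The remedy is a test series `G`, of order `e` prime to `p`, with `D G = c X^{pN} (1 + s X^q + ⋯)`.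
Since `X^{pN}` is nearly fixed by `T`, the `s`-term governs `D^p G`: when `m ≡ q` mod `p`, its
coefficient there is `c s a^{p-1} ∏ (i+1) q` over `i < p - 1`. Hence `f^p` has ramification number
`p m + q` exactly when `s ≠ 0` (`IsAbelSeries.pow_char`). Because `T` and `T^p` commute, the same
`G` serves `T^p` with the same `s` (`IsAbelSeries.of_commute`), and induction from `m = q` gives `q
(1 + p + ⋯ + p^n)`.

For `f = X + X^{q+1} U`, truncating `X^p ∫ dz / (f - z)` gives such a `G`, with `s = -U(0) resit(f)`
(`isAbelSeries_abelSeries`). Finally `P` comes from expanding the coefficient of `X^q` in `1 / U`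
(`coeff_inv_eq_sum`). -/

namespace WildSeries

open PowerSeries

/-! ### Difference operators on power series in characteristic `p`. -/

section Difference

variable {K : Type*} [Field K]

/-- The difference operator `u ↦ T u - u` of an endomorphism of `K⟦X⟧`. -/
noncomputable def diff (T : K⟦X⟧ →ₐ[K] K⟦X⟧) : Module.End K K⟦X⟧ := T.toLinearMap - 1

theorem diff_apply (T : K⟦X⟧ →ₐ[K] K⟦X⟧) (u : K⟦X⟧) : diff T u = T u - u := rfl

theorem toLinearMap_pow (T : K⟦X⟧ →ₐ[K] K⟦X⟧) (n : ℕ) :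
    (T ^ n).toLinearMap = (T.toLinearMap ^ n : Module.End K K⟦X⟧) := by
  ext1 u
  induction n generalizing u with
  | zero => rfl
  | succ n ih => rw [pow_succ, pow_succ]; exact ih (T u)

/-- Frobenius in the `K`-algebra of linear endomorphisms, where `T` commutes with `1`. -/
theorem diff_pow_char (p : ℕ) [Fact p.Prime] [CharP K p] (T : K⟦X⟧ →ₐ[K] K⟦X⟧) :
    diff (T ^ p) = diff T ^ p := by
  have : CharP (Module.End K K⟦X⟧) p :=
    charP_of_injective_algebraMap (algebraMap K (Module.End K K⟦X⟧)).injective p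
  rw [diff, diff, sub_pow_char_of_commute p (Commute.one_right _), one_pow, toLinearMap_pow]

theorem coeff_eq_of_X_pow_dvd_sub {u v : K⟦X⟧} {n k : ℕ} (h : X ^ n ∣ u - v) (hk : k < n) :
    coeff k u = coeff k v := by
  have := X_pow_dvd_iff.1 h k hk
  rwa [map_sub, sub_eq_zero] at this

theorem coeff_X_pow_mul_self (e : ℕ) (w : K⟦X⟧) : coeff e (X ^ e * w) = constantCoeff w := by
  rw [coeff_X_pow_mul', if_pos le_rfl, Nat.sub_self, coeff_zero_eq_constantCoeff]

theorem X_pow_succ_dvd {u : K⟦X⟧} {e : ℕ} (h : X ^ e ∣ u) (h0 : coeff e u = 0) :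
    X ^ (e + 1) ∣ u := by
  rw [X_pow_dvd_iff] at h ⊢
  intro k hk
  rcases Nat.lt_succ_iff_lt_or_eq.1 hk with hk | rfl
  exacts [h k hk, h0]

variable {T : K⟦X⟧ →ₐ[K] K⟦X⟧} {V : K⟦X⟧} {m : ℕ}

theorem X_pow_dvd_diff (hT : T X = X + X ^ (m + 1) * V) (w : K⟦X⟧) : X ^ (m + 1) ∣ diff T w := by
  suffices H : ∀ n ≤ m + 1, ∀ w, X ^ n ∣ diff T w from H _ le_rfl w
  intro n
  induction n with
  | zero => intro _ w; simp
  | succ n ih =>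
    intro hn w
    -- Constants are fixed by `T`, so only the twisted Leibniz rule for `X * w₁` matters.
    obtain ⟨w₁, c, rfl⟩ : ∃ w₁ c, w = X * w₁ + C c := ⟨_, _, eq_X_mul_shift_add_const w⟩
    have hC : T (C c) = C c := T.commutes c
    have e : diff T (X * w₁ + C c) = X ^ (m + 1) * V * T w₁ + X * diff T w₁ := by
      rw [diff_apply, diff_apply, map_add, map_mul, hT, hC]
      ring
    rw [e]
    refine dvd_add ((pow_dvd_pow X hn).mul_right _ |>.mul_right _) ?_
    rw [pow_succ']
    exact mul_dvd_mul_left X (ih (by omega) w₁)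

theorem one_add_pow_eq (x : K⟦X⟧) (e : ℕ) :
    ∃ y, (1 + x) ^ e = 1 + (e : K⟦X⟧) * x + (e.choose 2 : K⟦X⟧) * x ^ 2 + x ^ 3 * y := by
  induction e with
  | zero => exact ⟨0, by simp⟩
  | succ e ih =>
    obtain ⟨y, hy⟩ := ih
    refine ⟨y * (1 + x) + (e.choose 2 : K⟦X⟧), ?_⟩
    rw [pow_succ, hy, Nat.choose_succ_succ' e 1, Nat.choose_one_right]
    push_cast
    ring

theorem map_X_pow (hT : T X = X + X ^ (m + 1) * V) (e : ℕ) :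
    T (X ^ e) = X ^ e * (1 + X ^ m * V) ^ e := by
  rw [map_pow, hT, ← mul_pow]
  ring

theorem exists_eq_C_add_X_mul (u : K⟦X⟧) : ∃ u₁, u = C (constantCoeff u) + X * u₁ :=
  ⟨_, (eq_X_mul_shift_add_const u).trans (add_comm _ _)⟩

/-- To leading order `D` acts as the derivation `V(0) X^{m+1} d/dX`; the variation of `w` enters
only from order `e + m + 1`. -/
theorem diff_X_pow_mul (hT : T X = X + X ^ (m + 1) * V) (hm : 1 ≤ m) (e : ℕ) (w : K⟦X⟧) :
    ∃ R, diff T (X ^ e * w) =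
      X ^ (e + m) * (C ((e : K) * constantCoeff V * constantCoeff w) + X * R) := by
  obtain ⟨m, rfl⟩ := Nat.exists_eq_add_of_le' hm
  obtain ⟨r, hr⟩ := X_pow_dvd_diff hT w
  obtain ⟨y, hy⟩ := one_add_pow_eq (X ^ (m + 1) * V) e
  obtain ⟨v, hv⟩ := exists_eq_C_add_X_mul (V * w)
  have hTw : T w = w + X ^ (m + 1 + 1) * r := by rw [← hr, diff_apply]; ring
  refine ⟨r + (e : K⟦X⟧) * v + (e : K⟦X⟧) * X ^ (m + 1) * V * r +
    X ^ m * V ^ 2 * ((e.choose 2 : K⟦X⟧) + X ^ (m + 1) * V * y) * T w, ?_⟩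
  rw [mul_assoc (e : K), ← map_mul, map_mul C, map_natCast, diff_apply, map_mul, map_X_pow hT, hy, hTw]
  linear_combination (e : K⟦X⟧) * X ^ (e + (m + 1)) * hv

theorem X_pow_dvd_diff_of_dvd (hT : T X = X + X ^ (m + 1) * V) (hm : 1 ≤ m) {e : ℕ} {u : K⟦X⟧}
    (hu : X ^ e ∣ u) : X ^ (e + m) ∣ diff T u := by
  obtain ⟨w, rfl⟩ := hu
  obtain ⟨R, hR⟩ := diff_X_pow_mul hT hm e w
  exact hR ▸ dvd_mul_right _ _

theorem coeff_diff (hT : T X = X + X ^ (m + 1) * V) (hm : 1 ≤ m) {e : ℕ} {u : K⟦X⟧}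
    (hu : X ^ e ∣ u) :
    coeff (e + m) (diff T u) = (e : K) * constantCoeff V * coeff e u := by
  obtain ⟨w, rfl⟩ := hu
  obtain ⟨R, hR⟩ := diff_X_pow_mul hT hm e w
  rw [hR, coeff_X_pow_mul_self, coeff_X_pow_mul_self]
  simp

theorem X_pow_dvd_diff_pow (hT : T X = X + X ^ (m + 1) * V) (hm : 1 ≤ m) {e : ℕ} {u : K⟦X⟧}
    (hu : X ^ e ∣ u) (j : ℕ) : X ^ (e + j * m) ∣ (diff T ^ j) u := by
  induction j with
  | zero => simpa using hu
  | succ j ih =>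
    rw [pow_succ', Module.End.mul_apply, add_mul, one_mul, ← add_assoc]
    exact X_pow_dvd_diff_of_dvd hT hm ih

theorem coeff_diff_pow (hT : T X = X + X ^ (m + 1) * V) (hm : 1 ≤ m) {e : ℕ} {u : K⟦X⟧}
    (hu : X ^ e ∣ u) (j : ℕ) :
    coeff (e + j * m) ((diff T ^ j) u) =
      (∏ i ∈ Finset.range j, ((e + i * m : ℕ) : K)) * constantCoeff V ^ j * coeff e u := by
  induction j with
  | zero => simp
  | succ j ih =>
    rw [pow_succ', Module.End.mul_apply, add_mul, one_mul, ← add_assoc,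
      coeff_diff hT hm (X_pow_dvd_diff_pow hT hm hu j), ih, Finset.prod_range_succ]
    ring

variable (p : ℕ) [Fact p.Prime] [CharP K p]

/-- `X ^ (p N)` is almost invariant under substitution. -/
theorem diff_X_pow_char_mul (hT : T X = X + X ^ (m + 1) * V) (N : ℕ) (u : K⟦X⟧) :
    X ^ (p * N + p * m) ∣ diff T (X ^ (p * N) * u) - X ^ (p * N) * diff T u := by
  have hp : CharP K⟦X⟧ p := charP_of_injective_algebraMap (algebraMap K K⟦X⟧).injective p
  obtain ⟨y, hy⟩ := one_add_pow_eq ((X ^ m * V) ^ p) N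
  -- Frobenius moves the first correction from relative order `m` to `p m`.
  have h : T (X ^ (p * N)) = X ^ (p * N) * (1 + (X ^ m * V) ^ p) ^ N := by
    rw [map_X_pow hT, pow_mul (1 + _), add_pow_char, one_pow]
  refine ⟨V ^ p * ((N : K⟦X⟧) + (N.choose 2 : K⟦X⟧) * (X ^ m * V) ^ p +
    ((X ^ m * V) ^ p) ^ 2 * y) * T u, ?_⟩
  rw [diff_apply, diff_apply, map_mul, h, hy, pow_add, pow_mul' X p m, mul_pow]
  ring

end Difference

/-! ### Abel series and the ramification numbers of `p`-th powers. -/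

section Ramification

variable {K : Type*} [Field K] {T T' : K⟦X⟧ →ₐ[K] K⟦X⟧} {V V' G : K⟦X⟧} {m M q e E E' N N' : ℕ}
  {c c' s : K}

/-- `T G - G = c X ^ E (1 + s X ^ q + ⋯)`: up to the factor `X ^ E`, the series `G` is an approximate
Abel coordinate for `T`. -/
def IsAbelSeries (T : K⟦X⟧ →ₐ[K] K⟦X⟧) (q E : ℕ) (c s : K) (G : K⟦X⟧) : Prop :=
  X ^ (E + q + 1) ∣ diff T G - C c * (X ^ E + C s * X ^ (E + q))

theorem IsAbelSeries.dvd_diff_sub (h : IsAbelSeries T q E c s G) :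
    X ^ (E + q) ∣ diff T G - C c * X ^ E := by
  have h1 := (pow_dvd_pow (X : K⟦X⟧) (E + q).le_succ).trans h
  have h2 : X ^ (E + q) ∣ C (c * s) * (X : K⟦X⟧) ^ (E + q) := dvd_mul_left _ _
  convert dvd_add h1 h2 using 1
  rw [map_mul]
  ring

theorem IsAbelSeries.coeff_diff_sub (hq : 1 ≤ q) (h : IsAbelSeries T q E c s G) :
    coeff (E + q) (diff T G - C c * X ^ E) = c * s := by
  have h1 := coeff_eq_of_X_pow_dvd_sub h (k := E + q) (by omega)
  have hq0 : q ≠ 0 := by omega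
  rw [map_sub, h1]
  simp [coeff_X_pow, hq0]

theorem IsAbelSeries.coeff_eq (hq : 1 ≤ q) (h : IsAbelSeries T q E c s G) :
    coeff E (diff T G) = c := by
  rw [coeff_eq_of_X_pow_dvd_sub h.dvd_diff_sub (k := E) (by omega)]
  simp [coeff_X_pow]

/-- If `T G - G` is small then so is `T X - X`. -/
theorem X_pow_dvd_of_dvd_diff (hT : X ^ 2 ∣ T X - X) (he : (e : K) ≠ 0) (hG : X ^ e ∣ G)
    (hG0 : coeff e G ≠ 0) (hM : 1 ≤ M) (h : X ^ (e + M) ∣ diff T G) : X ^ (M + 1) ∣ T X - X := by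
  -- Bootstrapping: if the order of `T X - X` were exactly `j + 1` with `j < M`, then `D G` would
  -- have the nonzero coefficient `e V(0) coeff e G` in degree `e + j`.
  suffices H : ∀ j, 1 ≤ j → j ≤ M → X ^ (j + 1) ∣ T X - X from H M hM le_rfl
  intro j hj
  induction j, hj using Nat.le_induction with
  | base => intro _; exact hT
  | succ j hj ih =>
    intro hjM
    obtain ⟨V, hV⟩ := ih (by omega)
    have h1 := coeff_diff (sub_eq_iff_eq_add'.1 hV) hj hG
    rw [X_pow_dvd_iff.1 h _ (by omega)] at h1
    have h2 : constantCoeff V = 0 := by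
      rcases mul_eq_zero.1 h1.symm with h | h
      · exact (mul_eq_zero.1 h).resolve_left he
      · exact absurd h hG0
    refine X_pow_succ_dvd (hV ▸ dvd_mul_right _ _) ?_
    rw [hV, coeff_X_pow_mul_self, h2]

variable {p : ℕ} [Fact p.Prime] [CharP K p]

/-- The parameter `s` of an Abel series is the same for commuting endomorphisms. -/
theorem IsAbelSeries.of_commute (hT : T X = X + X ^ (m + 1) * V)
    (hT' : T' X = X + X ^ (M + 1) * V') (hcomm : Commute T T') (hm : q ≤ m) (hM : q ≤ M)
    (hq : 1 ≤ q) (hqp : q < p) (hp : 3 ≤ p) (hG : X ^ e ∣ G) (hE : e + m = p * N)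
    (hE' : e + M = p * N') (hc : c ≠ 0) (h : IsAbelSeries T q (p * N) c s G)
    (h' : coeff (p * N') (diff T' G) = c') : IsAbelSeries T' q (p * N') c' s G := by
  have hm1 : 1 ≤ m := hq.trans hm
  have hM1 : 1 ≤ M := hq.trans hM
  have hcc : c = e * constantCoeff V * coeff e G := by
    rw [← h.coeff_eq hq, ← hE, coeff_diff hT hm1 hG]
  have hcc' : c' = e * constantCoeff V' * coeff e G := by
    rw [← h', ← hE', coeff_diff hT' hM1 hG]
  have ha : constantCoeff V ≠ 0 := by
    rintro h0
    simp [hcc, h0] at hc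
  obtain ⟨W, hW⟩ : X ^ (p * N') ∣ diff T' G := hE' ▸ X_pow_dvd_diff_of_dvd hT' hM1 hG
  have hW0 : constantCoeff W = c' := by rw [← h', hW, coeff_X_pow_mul_self]
  have hpm : q + m + 1 ≤ p * m := by nlinarith
  have hpM : q + M + 1 ≤ p * M := by nlinarith
  -- the two sides of `D (D' G) = D' (D G)`
  have key1 : X ^ (p * N' + p * m) ∣ diff T (diff T' G) - X ^ (p * N') * diff T W := by
    rw [hW]
    exact diff_X_pow_char_mul p hT N' W
  have hDX : X ^ (p * N + p * M) ∣ diff T' (X ^ (p * N)) := by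
    have := diff_X_pow_char_mul p hT' N 1
    have h1 : diff T' 1 = 0 := by rw [diff_apply, map_one, sub_self]
    simpa [h1] using this
  have hsplit : diff T' (diff T G) =
      C c * diff T' (X ^ (p * N)) + diff T' (diff T G - C c * X ^ (p * N)) := by
    rw [map_sub, ← smul_eq_C_mul, ← smul_eq_C_mul, map_smul]
    ring
  have key2 : X ^ (p * N + q + M) ∣ diff T' (diff T G) := by
    rw [hsplit]
    exact dvd_add (((pow_dvd_pow X (by omega)).trans hDX).mul_left _)
      (X_pow_dvd_diff_of_dvd hT' hM1 h.dvd_diff_sub)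
  have key3 : coeff (p * N + q + M) (diff T' (diff T G)) = q * constantCoeff V' * (c * s) := by
    rw [hsplit, map_add, coeff_diff hT' hM1 h.dvd_diff_sub, h.coeff_diff_sub hq, coeff_C_mul,
      X_pow_dvd_iff.1 hDX _ (by omega)]
    simp
  have hDD : diff T (diff T' G) = diff T' (diff T G) := by
    have h1 : T (T' G) = T' (T G) := DFunLike.congr_fun hcomm.eq G
    simp only [diff_apply, map_sub, h1]
    ring
  rw [hDD] at key1
  -- Both sides equal `e + m + M + q`.
  have hindex : p * N + q + M = p * N' + (q + m) := by omega
  have hDW : ∀ i ≤ q, coeff (i + m) (diff T W) =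
      coeff (p * N' + (i + m)) (diff T' (diff T G)) := by
    intro i hi
    rw [coeff_eq_of_X_pow_dvd_sub key1 (by omega), coeff_X_pow_mul', if_pos (by omega),
      Nat.add_sub_cancel_left]
  have hDc : diff T (W - C c') = diff T W := by
    have : diff T (C c') = 0 := by
      rw [diff_apply, sub_eq_zero]
      exact T.commutes c'
    rw [map_sub, this, sub_zero]
  -- `D' D G` vanishes below the degree aligned with `q`, so `D W` has no terms below `X^{q+m}`. As
  -- `1, …, q - 1` are invertible in `K`, the coefficients of `W` in these degrees vanish one by
  -- one.
  have hWc : ∀ i, 1 ≤ i → i ≤ q → X ^ i ∣ W - C c' := by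
    intro i hi
    induction i, hi using Nat.le_induction with
    | base => intro _; rw [pow_one, X_dvd_iff, map_sub, hW0, constantCoeff_C, sub_self]
    | succ i hi ih =>
      intro hiq
      refine X_pow_succ_dvd (ih (by omega)) ?_
      have h1 := coeff_diff hT hm1 (ih (by omega))
      rw [hDc, hDW i (by omega), X_pow_dvd_iff.1 key2 _ (by omega)] at h1
      have hi0 : (i : K) ≠ 0 := by
        rw [Ne, CharP.cast_eq_zero_iff K p]
        exact Nat.not_dvd_of_pos_of_lt hi (by omega)
      exact (mul_eq_zero.1 h1.symm).resolve_left (mul_ne_zero hi0 ha)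
  have hWq : coeff q (W - C c') = c' * s := by
    have h1 := coeff_diff hT hm1 (hWc q hq le_rfl)
    have hq0 : (q : K) ≠ 0 := by
      rw [Ne, CharP.cast_eq_zero_iff K p]
      exact Nat.not_dvd_of_pos_of_lt hq hqp
    rw [hDc, hDW q le_rfl, ← hindex, key3] at h1
    -- The identity `c V'(0) = c' V(0)`, both sides being `e V(0) V'(0) coeff e G`, makes `s` the
    -- same for `T'`.
    apply mul_left_cancel₀ (mul_ne_zero hq0 ha)
    rw [← h1, hcc, hcc']
    ring
  have hfin : X ^ (q + 1) ∣ W - C c' - C (c' * s) * X ^ q := by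
    refine X_pow_succ_dvd (dvd_sub (hWc q hq le_rfl) (dvd_mul_left _ _)) ?_
    rw [map_sub, hWq, coeff_C_mul, coeff_X_pow_self, mul_one, sub_self]
  rw [IsAbelSeries, hW, add_assoc, pow_add]
  convert mul_dvd_mul_left (X ^ (p * N')) hfin using 1
  rw [map_mul]
  ring

theorem X_sq_dvd_pow (hT : T X = X + X ^ (m + 1) * V) (hm : 1 ≤ m) :
    X ^ 2 ∣ (T ^ p) X - X := by
  rw [← diff_apply, diff_pow_char]
  have h1 := X_pow_dvd_diff_pow hT hm (e := 1) (u := X) (by simp) p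
  refine (pow_dvd_pow X ?_).trans h1
  have := (Fact.out : p.Prime).pos
  nlinarith

/-- Of `D^p G = D^{p-1} (D G)`, the part coming from `c X^{pN}` has too high an order to matter; the
rest has leading term `c s X^{pN+q}`, whose exponent stays prime to `p` through the next `p - 1`
differences. -/
theorem IsAbelSeries.diff_pow (hT : T X = X + X ^ (m + 1) * V) (ha : constantCoeff V ≠ 0)
    (hq : 1 ≤ q) (hqp : q < p) (hp : 3 ≤ p) (hm : q ≤ m) (hmq : (m : K) = q) (hc : c ≠ 0)
    (h : IsAbelSeries T q (p * N) c s G) :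
    X ^ (p * N + q + (p - 1) * m) ∣ diff (T ^ p) G ∧
      (coeff (p * N + q + (p - 1) * m) (diff (T ^ p) G) = 0 ↔ s = 0) := by
  have hm1 : 1 ≤ m := hq.trans hm
  obtain ⟨r, rfl⟩ : ∃ r, p = r + 1 + 1 := ⟨p - 2, by omega⟩
  have hDX : X ^ ((r + 1 + 1) * N + (r + 1 + 1) * m) ∣ diff T (X ^ ((r + 1 + 1) * N)) := by
    have := diff_X_pow_char_mul (r + 1 + 1) hT N 1
    have h1 : diff T 1 = 0 := by rw [diff_apply, map_one, sub_self]
    simpa [h1] using this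
  have hDX' := X_pow_dvd_diff_pow hT hm1 hDX r
  have hsplit : diff (T ^ (r + 1 + 1)) G = C c * (diff T ^ r) (diff T (X ^ ((r + 1 + 1) * N))) +
      (diff T ^ (r + 1)) (diff T G - C c * X ^ ((r + 1 + 1) * N)) := by
    rw [diff_pow_char, pow_succ, Module.End.mul_apply, map_sub, ← smul_eq_C_mul, ← smul_eq_C_mul,
      map_smul, pow_succ (diff T) r, Module.End.mul_apply, Module.End.mul_apply]
    ring
  have hlt : (r + 1 + 1) * N + q + (r + 1) * m + 1 ≤
      (r + 1 + 1) * N + (r + 1 + 1) * m + r * m := by nlinarith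
  rw [Nat.add_sub_cancel, hsplit]
  refine ⟨dvd_add (((pow_dvd_pow X (by omega)).trans hDX').mul_left _)
    (X_pow_dvd_diff_pow hT hm1 h.dvd_diff_sub _), ?_⟩
  rw [map_add, coeff_C_mul, X_pow_dvd_iff.1 hDX' _ (by omega),
    coeff_diff_pow hT hm1 h.dvd_diff_sub, h.coeff_diff_sub hq, mul_zero, zero_add]
  have hprod : ∏ i ∈ Finset.range (r + 1), (((r + 1 + 1) * N + q + i * m : ℕ) : K) ≠ 0 := by
    refine Finset.prod_ne_zero_iff.2 fun i hi => ?_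
    rw [Finset.mem_range] at hi
    have e1 : (((r + 1 + 1) * N + q + i * m : ℕ) : K) = (((i + 1) * q : ℕ) : K) := by
      have h0 : (((r + 1 + 1 : ℕ) : K)) = 0 := CharP.cast_eq_zero K _
      push_cast at h0 ⊢
      rw [hmq, h0]
      ring
    rw [e1, Ne, CharP.cast_eq_zero_iff K (r + 1 + 1), (Fact.out : (r + 1 + 1).Prime).dvd_mul]
    exact not_or.2 ⟨Nat.not_dvd_of_pos_of_lt (by omega) (by omega),
      Nat.not_dvd_of_pos_of_lt hq hqp⟩
  rw [mul_eq_zero, or_iff_right (mul_ne_zero hprod (pow_ne_zero _ ha)), mul_eq_zero,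
    or_iff_right hc]

/-- The order of `T ^ p - 1` in terms of an Abel series for `T`. -/
theorem IsAbelSeries.pow_char (hT : T X = X + X ^ (m + 1) * V) (ha : constantCoeff V ≠ 0)
    (hq : 1 ≤ q) (hqp : q < p) (hp : 3 ≤ p) (hm : q ≤ m) (hmq : (m : K) = q) (hc : c ≠ 0)
    (hG : X ^ e ∣ G) (hE : e + m = p * N) (h : IsAbelSeries T q (p * N) c s G) :
    ∃ V', (T ^ p) X = X + X ^ (p * m + q + 1) * V' ∧ (constantCoeff V' = 0 ↔ s = 0) ∧
      (s ≠ 0 → ∃ N' c', e + (p * m + q) = p * N' ∧ c' ≠ 0 ∧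
        IsAbelSeries (T ^ p) q (p * N') c' s G) := by
  have hm1 : 1 ≤ m := hq.trans hm
  obtain ⟨h1, h2⟩ := h.diff_pow hT ha hq hqp hp hm hmq hc
  have hF : p * N + q + (p - 1) * m = e + (p * m + q) := by
    obtain ⟨r, rfl⟩ : ∃ r, p = r + 1 := ⟨p - 1, by omega⟩
    rw [← hE, Nat.add_sub_cancel]
    ring
  rw [hF] at h1 h2
  have hcG : c = e * constantCoeff V * coeff e G := by
    rw [← h.coeff_eq hq, ← hE, coeff_diff hT hm1 hG]
  have he0 : (e : K) ≠ 0 := by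
    rintro h0
    simp [hcG, h0] at hc
  have hG0 : coeff e G ≠ 0 := by
    rintro h0
    simp [hcG, h0] at hc
  have hM1 : 1 ≤ p * m + q := by omega
  obtain ⟨V', hV'⟩ := X_pow_dvd_of_dvd_diff (X_sq_dvd_pow hT hm1) he0 hG hG0 hM1 h1
  have hV' := sub_eq_iff_eq_add'.1 hV'
  refine ⟨V', hV', ?_, fun hs => ?_⟩
  · rw [← h2, coeff_diff hV' hM1 hG]
    simp [he0, hG0]
  · have hdvd : p ∣ e + (p * m + q) := by
      rw [← CharP.cast_eq_zero_iff K p]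
      have h0 : ((e + m : ℕ) : K) = 0 := by rw [hE]; simp
      push_cast at h0 ⊢
      rw [hmq] at h0
      simp [h0, CharP.cast_eq_zero, add_comm]
    obtain ⟨N', hN'⟩ := hdvd
    rw [hN'] at h2
    exact ⟨N', _, hN', fun h0 => hs (h2.1 h0),
      h.of_commute hT hV' (Commute.self_pow T p) hm (by nlinarith) hq hqp hp hG hE hN' hc rfl⟩

/-- If the parameter `s` is nonzero, then all ramification numbers are determined. -/
theorem IsAbelSeries.pow_char_pow (hT : T X = X + X ^ (q + 1) * V) (ha : constantCoeff V ≠ 0)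
    (hq : 1 ≤ q) (hqp : q < p) (hp : 3 ≤ p) (hc : c ≠ 0) (hG : X ^ e ∣ G) (hE : e + q = p * N)
    (h : IsAbelSeries T q (p * N) c s G) (hs : s ≠ 0) (n : ℕ) :
    ∃ V', (T ^ p ^ n) X = X + X ^ (q * ∑ i ∈ Finset.range (n + 1), p ^ i + 1) * V' ∧
      constantCoeff V' ≠ 0 := by
  -- The induction must also carry an Abel series with the unchanged `G` and `s`.
  suffices H : ∃ V', (T ^ p ^ n) X = X + X ^ (q * ∑ i ∈ Finset.range (n + 1), p ^ i + 1) * V' ∧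
      constantCoeff V' ≠ 0 ∧ ∃ N' c', e + q * ∑ i ∈ Finset.range (n + 1), p ^ i = p * N' ∧
        c' ≠ 0 ∧ IsAbelSeries (T ^ p ^ n) q (p * N') c' s G by
    obtain ⟨V', h1, h2, -⟩ := H
    exact ⟨V', h1, h2⟩
  induction n with
  | zero => exact ⟨V, by simpa using hT, ha, N, c, by simpa using hE, hc, by simpa using h⟩
  | succ n ih =>
    obtain ⟨V₁, hV₁, ha₁, N₁, c₁, hE₁, hc₁, h₁⟩ := ih
    have hsum : ∀ k, q * ∑ i ∈ Finset.range (k + 1), p ^ i =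
        p * (q * ∑ i ∈ Finset.range k, p ^ i) + q := by
      intro k
      simp only [Finset.sum_range_succ', pow_succ, pow_zero, ← Finset.sum_mul]
      ring
    have hm : q ≤ q * ∑ i ∈ Finset.range (n + 1), p ^ i := by
      rw [hsum]; omega
    have hmq : ((q * ∑ i ∈ Finset.range (n + 1), p ^ i : ℕ) : K) = q := by
      rw [hsum]; push_cast; simp
    obtain ⟨V₂, hV₂, hs₂, h₂⟩ := h₁.pow_char hV₁ ha₁ hq hqp hp hm hmq hc₁ hG hE₁
    obtain ⟨N₂, c₂, hE₂, hc₂, h₃⟩ := h₂ hs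
    rw [← hsum (n + 1)] at hV₂ hE₂
    rw [← pow_mul, ← pow_succ] at hV₂ h₃
    exact ⟨V₂, hV₂, fun h0 => hs (hs₂.1 h0), N₂, c₂, hE₂, hc₂, h₃⟩

end Ramification

/-! ### An explicit Abel series with parameter `-U(0) resit(f)`. -/

section AbelSeries

variable {K : Type*} [Field K] {T : K⟦X⟧ →ₐ[K] K⟦X⟧} {U : K⟦X⟧} {p q : ℕ}

/-- A truncation of `X ^ p` times a primitive of `1 / (T X - X)`, where `T X - X = X ^ (q + 1) U`. -/
noncomputable def abelSeries (p q : ℕ) (U : K⟦X⟧) : K⟦X⟧ :=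
  ∑ i ∈ Finset.range q, C (coeff i U⁻¹ / (i - q)) * X ^ (p - q + i)

theorem X_pow_dvd_abelSeries : X ^ (p - q) ∣ abelSeries p q U :=
  Finset.dvd_sum fun _ _ => (pow_dvd_pow X (Nat.le_add_right _ _)).mul_left _

theorem X_pow_dvd_sub_sum_coeff (u : K⟦X⟧) (n : ℕ) :
    X ^ n ∣ u - ∑ i ∈ Finset.range n, C (coeff i u) * X ^ i := by
  rw [X_pow_dvd_iff]
  intro k hk
  rw [map_sub, map_sum]
  simp [coeff_X_pow, hk]

variable [CharP K p]

theorem cast_sub_add_eq (hqp : q < p) (i : ℕ) : ((p - q + i : ℕ) : K) = i - q := by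
  have h : ((p - q + q : ℕ) : K) = 0 := by rw [Nat.sub_add_cancel hqp.le, CharP.cast_eq_zero]
  push_cast at h ⊢
  linear_combination h

theorem sub_cast_ne_zero (hqp : q < p) {i : ℕ} (hi : i < q) : (i - q : K) ≠ 0 := by
  rw [← cast_sub_add_eq hqp, Ne, CharP.cast_eq_zero_iff K p]
  exact Nat.not_dvd_of_pos_of_lt (by omega) (by omega)

theorem two_ne_zero_of_charP (hp : 3 ≤ p) : (2 : K) ≠ 0 := by
  have : ((2 : ℕ) : K) ≠ 0 := by
    rw [Ne, CharP.cast_eq_zero_iff K p]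
    exact Nat.not_dvd_of_pos_of_lt (by omega) (by omega)
  exact_mod_cast this

/-- The denominator `i - q` cancels the exponent `p - q + i` in the linear term. The quadratic term
leaves `b (i - q - 1) / 2`, which at `i = 0` produces the `(q + 1) / 2` of the iterative residue. -/
theorem diff_abelSeries_term (hT : T X = X + X ^ (q + 1) * U) (hq : 1 ≤ q) (hqp : q < p)
    (hp : 3 ≤ p) {i : ℕ} (hi : i < q) (b : K) :
    ∃ w, diff T (C (b / (i - q)) * X ^ (p - q + i)) = X ^ p * (C b * X ^ i * U + X ^ (q + i) * w) ∧
      constantCoeff w = b * (i - q - 1) / 2 * constantCoeff U ^ 2 := by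
  have h2 : NeZero (2 : K) := ⟨two_ne_zero_of_charP hp⟩
  have hne : (i - q : K) ≠ 0 := sub_cast_ne_zero hqp hi
  obtain ⟨y, hy⟩ := one_add_pow_eq (X ^ q * U) (p - q + i)
  refine ⟨C (b * (i - q - 1) / 2) * U ^ 2 + X ^ q * (C (b / (i - q)) * U ^ 3 * y), ?_, ?_⟩
  · have h1 : C (b / (i - q)) * ((p - q + i : ℕ) : K⟦X⟧) = C b := by
      rw [← map_natCast (C (R := K)), cast_sub_add_eq hqp, ← map_mul, div_mul_cancel₀ _ hne]
    have h3 : C (b / (i - q)) * (((p - q + i).choose 2 : ℕ) : K⟦X⟧) = C (b * (i - q - 1) / 2) := by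
      rw [← map_natCast (C (R := K)), Nat.cast_choose_two, cast_sub_add_eq hqp, ← map_mul]
      congr 1
      rw [div_mul_div_comm, mul_left_comm, mul_div_mul_left _ _ hne]
    have hexp : (X : K⟦X⟧) ^ (p - q + i) * X ^ q = X ^ p * X ^ i := by
      rw [← pow_add, ← pow_add]
      congr 1
      omega
    rw [← smul_eq_C_mul, map_smul, smul_eq_C_mul, diff_apply, map_X_pow hT, hy, ← h1, ← h3,
      pow_add X q i]
    linear_combination (C (b / (i - q)) * ((p - q + i : ℕ) : K⟦X⟧) * U +
      C (b / (i - q)) * (((p - q + i).choose 2 : ℕ) : K⟦X⟧) * X ^ q * U ^ 2 +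
      C (b / (i - q)) * X ^ (2 * q) * U ^ 3 * y) * hexp
  · have hq0 : q ≠ 0 := by omega
    simp [hq0]

/-- The linear terms sum to `U` times the truncation of `U⁻¹` below degree `q`, that is, `1 - U(0)
coeff q U⁻¹ X^q + ⋯`: the residue term `i = q` has no primitive and is missing. In degree `q` only
the quadratic term of `i = 0` contributes further. -/
theorem isAbelSeries_abelSeries (hT : T X = X + X ^ (q + 1) * U) (ha : constantCoeff U ≠ 0)
    (hq : 1 ≤ q) (hqp : q < p) (hp : 3 ≤ p) :
    IsAbelSeries T q p 1 (-(constantCoeff U * (coeff q U⁻¹ + (q + 1) / 2))) (abelSeries p q U) := by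
  choose! w hw hw0 using fun i (hi : i < q) => diff_abelSeries_term hT hq hqp hp hi (coeff i U⁻¹)
  obtain ⟨r, hr⟩ := X_pow_dvd_sub_sum_coeff U⁻¹ (q + 1)
  have hUU : U * U⁻¹ = 1 := PowerSeries.mul_inv_cancel U ha
  have hdiff : diff T (abelSeries p q U) = X ^ p *
      ((∑ i ∈ Finset.range q, C (coeff i U⁻¹) * X ^ i) * U +
        ∑ i ∈ Finset.range q, X ^ (q + i) * w i) := by
    rw [abelSeries, map_sum, Finset.sum_mul, ← Finset.sum_add_distrib, Finset.mul_sum]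
    exact Finset.sum_congr rfl fun i hi => hw i (Finset.mem_range.1 hi)
  have hsum : ∃ t, ∑ i ∈ Finset.range q, X ^ (q + i) * w i =
      X ^ q * C (constantCoeff (w 0)) + X ^ (q + 1) * t := by
    obtain ⟨n, rfl⟩ : ∃ n, q = n + 1 := ⟨q - 1, by omega⟩
    obtain ⟨v, hv⟩ := exists_eq_C_add_X_mul (w 0)
    refine ⟨v + ∑ i ∈ Finset.range n, X ^ i * w (i + 1), ?_⟩
    rw [Finset.sum_range_succ', mul_add (X ^ (n + 1 + 1)), Finset.mul_sum]
    have : ∀ i ∈ Finset.range n, X ^ (n + 1 + (i + 1)) * w (i + 1) =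
        X ^ (n + 1 + 1) * (X ^ i * w (i + 1)) := fun i _ => by ring
    rw [Finset.sum_congr rfl this]
    linear_combination X ^ (n + 1) * hv
  obtain ⟨t, ht⟩ := hsum
  obtain ⟨v, hv⟩ := exists_eq_C_add_X_mul U
  have hw00 : constantCoeff (w 0) = - (constantCoeff U * ((q + 1) / 2)) := by
    rw [hw0 0 (by omega), coeff_zero_eq_constantCoeff, constantCoeff_inv]
    field_simp
    push_cast
    ring
  rw [Finset.sum_range_succ] at hr
  rw [IsAbelSeries, hdiff, ht, hw00, map_one, one_mul, add_assoc p, pow_add X p, pow_add X p]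
  refine ⟨t - r * U - C (coeff q U⁻¹) * v, ?_⟩
  simp only [map_neg, map_mul, map_add]
  linear_combination (X : K⟦X⟧) ^ p * hUU - X ^ p * U * hr - C (coeff q U⁻¹) * X ^ p * X ^ q * hv

end AbelSeries

/-! ### Iterates, indices, and the criterion by the iterative residue. -/

section Main

variable {K : Type*} [Field K]

theorem order_eq_natCast_iff {u : K⟦X⟧} {n : ℕ} :
    u.order = n ↔ ∃ V, u = X ^ n * V ∧ constantCoeff V ≠ 0 := by
  rw [order_eq_nat, ← X_pow_dvd_iff]
  constructor
  · rintro ⟨h, V, rfl⟩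
    exact ⟨V, rfl, by rwa [coeff_X_pow_mul_self] at h⟩
  · rintro ⟨V, rfl, h⟩
    exact ⟨by rwa [coeff_X_pow_mul_self], dvd_mul_right _ _⟩

theorem mult_eq_natCast_iff {f : K⟦X⟧} {n : ℕ} :
    mult f = n ↔ ∃ V, f = X + X ^ n * V ∧ constantCoeff V ≠ 0 := by
  rw [mult, order_eq_natCast_iff]
  simp only [sub_eq_iff_eq_add']

theorem natCast_le_mult_iff {f : K⟦X⟧} {n : ℕ} : (n : ℕ∞) ≤ mult f ↔ X ^ n ∣ f - X := by
  rw [mult, X_pow_dvd_iff]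
  exact ⟨fun h m hm => coeff_of_lt_order m (lt_of_lt_of_le (by exact_mod_cast hm) h),
    fun h => nat_le_order _ _ h⟩

/-- Subtraction is truncated, so `n = 0` would also allow `a = 0`. -/
theorem enat_sub_one_eq_natCast_iff {a : ℕ∞} {n : ℕ} (hn : 1 ≤ n) :
    a - 1 = n ↔ a = ((n + 1 : ℕ) : ℕ∞) := by
  cases a with
  | top => exact iff_of_false (by simp) (ENat.natCast_ne_top _).symm
  | coe k =>
    norm_cast
    omega

/-- The iterates of `f` are given by the powers of the substitution endomorphism. -/
theorem exists_iter_eq {f : K⟦X⟧} (hf : constantCoeff f = 0) :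
    ∃ T : K⟦X⟧ →ₐ[K] K⟦X⟧, T X = f ∧ ∀ n, iter f n = (T ^ n) X := by
  have hs := HasSubst.of_constantCoeff_zero' hf
  have hsucc : ∀ n, iter f (n + 1) = subst (iter f n) f :=
    fun n => Function.iterate_succ_apply' _ _ _
  have h0 : ∀ n, constantCoeff (iter f n) = 0 := by
    intro n
    induction n with
    | zero => exact constantCoeff_X
    | succ n ih => rw [hsucc]; exact constantCoeff_subst_eq_zero ih _ hf
  have H : ∀ n u, subst (iter f n) u = (substAlgHom hs ^ n : K⟦X⟧ →ₐ[K] K⟦X⟧) u := by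
    intro n
    induction n with
    | zero => intro u; exact X_subst u
    | succ n ih =>
      intro u
      rw [hsucc, ← subst_comp_subst_apply hs (HasSubst.of_constantCoeff_zero' (h0 n)), ih, pow_succ]
      rw [← coe_substAlgHom hs]
      rfl
  exact ⟨substAlgHom hs, substAlgHom_X hs,
    fun n => by rw [← H, subst_X (HasSubst.of_constantCoeff_zero' (h0 n))]⟩

theorem ind_eq {U : K⟦X⟧} {q : ℕ} (hU : constantCoeff U ≠ 0) :
    ind (X + X ^ (q + 1) * U) = - coeff q U⁻¹ := by
  have hinv : (((X - (X + X ^ (q + 1) * U) : K⟦X⟧) : LaurentSeries K)⁻¹) =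
      HahnSeries.single (-(q + 1 : ℤ)) (-1 : K) * ((U⁻¹ : K⟦X⟧) : LaurentSeries K) := by
    symm
    apply eq_inv_of_mul_eq_one_left
    have h1 : (X - (X + X ^ (q + 1) * U) : K⟦X⟧) = - (X ^ (q + 1) * U) := by ring
    have h2 : ((U⁻¹ : K⟦X⟧) : LaurentSeries K) * ((U : K⟦X⟧) : LaurentSeries K) = 1 := by
      rw [← map_mul, PowerSeries.inv_mul_cancel U hU, map_one]
    rw [h1, map_neg (HahnSeries.ofPowerSeries ℤ K), map_mul (HahnSeries.ofPowerSeries ℤ K),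
      HahnSeries.ofPowerSeries_X_pow]
    have h3 : HahnSeries.single (-(q + 1 : ℤ)) (-1 : K) * HahnSeries.single ((q + 1 : ℕ) : ℤ) 1 =
        -1 := by
      rw [HahnSeries.single_mul_single, Nat.cast_add_one, neg_add_cancel, mul_one]
      exact map_neg (HahnSeries.C : K →+* LaurentSeries K) 1
    linear_combination (-(((U⁻¹ : K⟦X⟧) : LaurentSeries K) * ((U : K⟦X⟧) : LaurentSeries K))) * h3 +
      h2
  rw [ind, hinv]
  have h4 : (-1 : ℤ) = q + -(q + 1 : ℤ) := by ring
  rw [h4, HahnSeries.coeff_single_mul_add]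
  rw [LaurentSeries.coeff_coe_powerSeries]
  ring

theorem resit_eq {U : K⟦X⟧} {q : ℕ} (hU : constantCoeff U ≠ 0) :
    resit (X + X ^ (q + 1) * U) = coeff q U⁻¹ + (q + 1) / 2 := by
  have h : mult (X + X ^ (q + 1) * U) = ((q + 1 : ℕ) : ℕ∞) := mult_eq_natCast_iff.2 ⟨U, rfl, hU⟩
  rw [resit, h, ind_eq hU, ENat.toNat_natCast]
  push_cast
  ring

variable {p q : ℕ}

theorem IsQRamified.mult_eq {f : K⟦X⟧} (hq : 1 ≤ q) (h : IsQRamified p q f) :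
    mult f = ((q + 1 : ℕ) : ℕ∞) := by
  have hf0 : constantCoeff f = 0 := by
    have h2 : ((2 : ℕ) : ℕ∞) ≤ mult f := h.1
    have := coeff_eq_of_X_pow_dvd_sub (natCast_le_mult_iff.1 h2) (k := 0) (by omega)
    simpa using this
  have h0 := h.2 0
  have h1 : iter f (p ^ 0) = f := by
    obtain ⟨T, hTf, hiter⟩ := exists_iter_eq hf0
    rw [hiter, pow_zero, pow_one, hTf]
  have h2 : q * ∑ i ∈ Finset.range (0 + 1), p ^ i = q := by simp
  rwa [lowerRamificationNumber, h1, h2, enat_sub_one_eq_natCast_iff hq] at h0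

variable [Fact p.Prime] [CharP K p]

theorem isQRamified_iff_resit_ne_zero (hp : 3 ≤ p) (hq : 1 ≤ q) (hqp : q < p) {f : K⟦X⟧}
    (hf : mult f = ((q + 1 : ℕ) : ℕ∞)) : IsQRamified p q f ↔ resit f ≠ 0 := by
  obtain ⟨U, hfU, hU⟩ := mult_eq_natCast_iff.1 hf
  have hf0 : constantCoeff f = 0 := by simp [hfU]
  obtain ⟨T, hTf, hiter⟩ := exists_iter_eq hf0
  have hT : T X = X + X ^ (q + 1) * U := hTf.trans hfU
  have hresit : resit f = coeff q U⁻¹ + (q + 1) / 2 := hfU ▸ resit_eq hU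
  have hE : p - q + q = p * 1 := by omega
  have hA : IsAbelSeries T q (p * 1) 1 (-(constantCoeff U * resit f)) (abelSeries p q U) := by
    rw [mul_one, hresit]
    exact isAbelSeries_abelSeries hT hU hq hqp hp
  have hs0 : -(constantCoeff U * resit f) = 0 ↔ resit f = 0 := by simp [hU]
  constructor
  · rintro ⟨-, h⟩ h0
    obtain ⟨V, hV, hV0, -⟩ := hA.pow_char hT hU hq hqp hp le_rfl rfl one_ne_zero
      X_pow_dvd_abelSeries hE
    -- Already `i_1` detects a vanishing residue: the term of degree `p q + q + 1` then disappears
    -- from `f^p - X`.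
    have h1 := h 1
    rw [lowerRamificationNumber, hiter, pow_one] at h1
    have h2 : mult ((T ^ p) X) = ((p * q + q + 1 : ℕ) : ℕ∞) := by
      have h3 : (q * ∑ i ∈ Finset.range (1 + 1), p ^ i : ℕ) = p * q + q := by
        simp [Finset.sum_range_succ]
        ring
      rwa [h3, enat_sub_one_eq_natCast_iff (by omega)] at h1
    obtain ⟨V', hV', hV'0⟩ := mult_eq_natCast_iff.1 h2
    have h5 : V = V' := by
      have := hV.symm.trans hV'
      exact mul_left_cancel₀ (pow_ne_zero _ X_ne_zero) (add_left_cancel this)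
    exact hV'0 (h5 ▸ hV0.2 (hs0.2 h0))
  · intro h0
    refine ⟨?_, fun n => ?_⟩
    · rw [IsWildlyRamified, hf]
      exact_mod_cast (by omega : 2 ≤ q + 1)
    · obtain ⟨V, hV, hV0⟩ := hA.pow_char_pow hT hU hq hqp hp one_ne_zero
        X_pow_dvd_abelSeries hE (fun h => h0 (hs0.1 h)) n
      rw [lowerRamificationNumber, hiter, enat_sub_one_eq_natCast_iff]
      · exact mult_eq_natCast_iff.2 ⟨V, hV, hV0⟩
      · exact Nat.mul_pos hq (Finset.sum_pos (fun _ _ => pow_pos (by omega) _) (by simp))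

end Main

/-! ### The explicit polynomial as the expansion of a reciprocal series. -/

section Polynomial

theorem sum_neg_pow_mul_pow_eq_sum_piAntidiag {ι R : Type*} [Fintype ι] [DecidableEq ι] [CommRing R]
    (i₀ : ι) (y : ι → R) (n : ℕ) :
    ∑ k ∈ Finset.range (n + 1), (-∑ j ∈ Finset.univ.erase i₀, y j) ^ k * y i₀ ^ (n - k) =
      ∑ κ ∈ Finset.piAntidiag Finset.univ n, (-1) ^ (n - κ i₀) *
        (Nat.multinomial (Finset.univ.erase i₀) κ : R) * ∏ j, y j ^ κ j := by
  have hk : ∀ k ∈ Finset.range (n + 1),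
      (-∑ j ∈ Finset.univ.erase i₀, y j) ^ k * y i₀ ^ (n - k) =
      ∑ κ ∈ Finset.piAntidiag (Finset.univ.erase i₀) k, (-1) ^ k *
        (Nat.multinomial (Finset.univ.erase i₀) κ : R) *
        (y i₀ ^ (n - k) * ∏ j ∈ Finset.univ.erase i₀, y j ^ κ j) := by
    intro k _
    rw [neg_pow, Finset.sum_pow_eq_sum_piAntidiag, Finset.mul_sum, Finset.sum_mul]
    exact Finset.sum_congr rfl fun κ _ => by ring
  rw [Finset.sum_congr rfl hk, Finset.sum_sigma']
  have hsum : ∀ κ : ι → ℕ, ∑ j, κ j = κ i₀ + ∑ j ∈ Finset.univ.erase i₀, κ j :=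
    fun κ => (Finset.add_sum_erase _ _ (Finset.mem_univ i₀)).symm
  have hupd : ∀ (κ : ι → ℕ) (a : ℕ), ∀ j ∈ Finset.univ.erase i₀, Function.update κ i₀ a j = κ j :=
    fun κ a j hj => Function.update_of_ne (Finset.ne_of_mem_erase hj) _ _
  -- The entry at `i₀` records the exponent `n - k`; it is reset to `0` on the way back because
  -- `piAntidiag` over the erased set requires support there.
  refine Finset.sum_bij' (fun s _ => Function.update s.2 i₀ (n - s.1))
    (fun κ _ => ⟨n - κ i₀, Function.update κ i₀ 0⟩) ?_ ?_ ?_ ?_ ?_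
  · rintro ⟨k, κ⟩ h
    simp only [Finset.mem_sigma, Finset.mem_range, Finset.mem_piAntidiag] at h ⊢
    refine ⟨?_, by simp⟩
    rw [hsum, Function.update_self, Finset.sum_congr rfl (hupd κ _), h.2.1]
    omega
  · intro κ h
    simp only [Finset.mem_sigma, Finset.mem_range, Finset.mem_piAntidiag] at h ⊢
    have h1 : κ i₀ + (Finset.univ.erase i₀).sum κ = n := (hsum κ).symm.trans h.1
    refine ⟨by omega, (Finset.sum_congr rfl (hupd κ _)).trans ?_, fun j hj => ?_⟩
    · exact Nat.eq_sub_of_add_eq' h1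
    · rw [Finset.mem_erase]
      refine ⟨?_, Finset.mem_univ j⟩
      rintro rfl
      simp at hj
  · rintro ⟨k, κ⟩ h
    simp only [Finset.mem_sigma, Finset.mem_range, Finset.mem_piAntidiag] at h
    have h0 : κ i₀ = 0 := by
      by_contra h0
      simpa using h.2.2 i₀ h0
    have h1 : n - (n - k) = k := by omega
    have h2 : Function.update κ i₀ 0 = κ := by rw [← h0, Function.update_eq_self]
    simp [h1, h2]
  · intro κ h
    simp only [Finset.mem_piAntidiag] at h
    have h1 : κ i₀ + (Finset.univ.erase i₀).sum κ = n := (hsum κ).symm.trans h.1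
    have h2 : n - (n - κ i₀) = κ i₀ := by omega
    simp [h2]
  · rintro ⟨k, κ⟩ h
    simp only [Finset.mem_sigma, Finset.mem_range] at h
    have h1 : n - (n - k) = k := by omega
    have h2 : ∏ j ∈ Finset.univ.erase i₀, y j ^ Function.update κ i₀ (n - k) j =
        ∏ j ∈ Finset.univ.erase i₀, y j ^ κ j :=
      Finset.prod_congr rfl fun j hj => by rw [hupd κ _ j hj]
    rw [← Finset.mul_prod_erase _ _ (Finset.mem_univ i₀), Function.update_self, h1,
      Nat.multinomial_congr (hupd κ _), h2]

variable {K : Type*} [Field K] {q : ℕ}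

/-- Write `U = a + V` modulo `X^{q+1}`, with `a = U(0)` and `X ∣ V`. Since `(-V)^{q+1}` vanishes
modulo `X^{q+1}`, the finite geometric sum `∑ (-V)^k a^{q-k}` represents `a^{q+1} U⁻¹`; the
multinomial theorem does the rest. -/
theorem coeff_inv_eq_sum {U : K⟦X⟧} (hU : constantCoeff U ≠ 0) (q : ℕ) :
    constantCoeff U ^ (q + 1) * coeff q U⁻¹ =
      ∑ ι ∈ (Finset.piAntidiag (Finset.univ : Finset (Fin (q + 1))) q).filter
        (fun ι => ∑ j : Fin (q + 1), (j : ℕ) * ι j = q),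
      ((-1 : K) ^ (q - ι 0) * (Nat.multinomial (Finset.univ.erase (0 : Fin (q + 1))) ι : K)) *
        ∏ j : Fin (q + 1), coeff j U ^ ι j := by
  set y : Fin (q + 1) → K⟦X⟧ := fun j => C (coeff j U) * X ^ (j : ℕ) with hy
  set V : K⟦X⟧ := ∑ j ∈ Finset.univ.erase 0, y j with hV
  have hy0 : y 0 = C (constantCoeff U) := by simp [hy]
  have hXV : X ∣ V := by
    refine Finset.dvd_sum fun j hj => ?_
    have : (j : ℕ) ≠ 0 := fun h => Finset.ne_of_mem_erase hj (Fin.ext h)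
    exact (dvd_pow_self X this).mul_left _
  have hUV : X ^ (q + 1) ∣ U - (y 0 + V) := by
    rw [hV, Finset.add_sum_erase _ _ (Finset.mem_univ _), hy,
      Fin.sum_univ_eq_sum_range (fun i => C (coeff i U) * X ^ i)]
    exact X_pow_dvd_sub_sum_coeff U (q + 1)
  have hgeom := geom_sum₂_mul (-V) (y 0) (q + 1)
  have hUU : U⁻¹ * U = 1 := PowerSeries.inv_mul_cancel U hU
  set S := ∑ i ∈ Finset.range (q + 1), (-V) ^ i * y 0 ^ (q + 1 - 1 - i) with hS
  have hmain : X ^ (q + 1) ∣ C (constantCoeff U ^ (q + 1)) * U⁻¹ - S := by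
    obtain ⟨r, hr⟩ := hUV
    obtain ⟨v, hv⟩ := pow_dvd_pow_of_dvd ((dvd_neg (a := X)).2 hXV) (q + 1)
    refine ⟨U⁻¹ * (v - r * S), ?_⟩
    rw [hv] at hgeom
    rw [map_pow, ← hy0]
    linear_combination U⁻¹ * hgeom + S * hUU - U⁻¹ * S * hr
  rw [← coeff_C_mul, coeff_eq_of_X_pow_dvd_sub hmain (by omega), hS, Nat.add_sub_cancel, hV,
    sum_neg_pow_mul_pow_eq_sum_piAntidiag, map_sum, Finset.sum_filter]
  refine Finset.sum_congr rfl fun ι _ => ?_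
  have hprod : ∏ j, y j ^ ι j =
      C (∏ j : Fin (q + 1), coeff (j : ℕ) U ^ ι j) * X ^ (∑ j : Fin (q + 1), (j : ℕ) * ι j) := by
    rw [← Finset.prod_pow_eq_pow_sum, map_prod, ← Finset.prod_mul_distrib]
    exact Finset.prod_congr rfl fun j _ => by rw [hy, mul_pow, map_pow, ← pow_mul]
  have hconst : ((-1 : K⟦X⟧) ^ (q - ι 0) *
      (Nat.multinomial (Finset.univ.erase (0 : Fin (q + 1))) ι : K⟦X⟧)) =
      C ((-1 : K) ^ (q - ι 0) * (Nat.multinomial (Finset.univ.erase (0 : Fin (q + 1))) ι : K)) := by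
    simp
  rw [hprod, hconst, coeff_C_mul, coeff_C_mul, coeff_X_pow]
  split_ifs with h1 h2 h2
  · rw [mul_one]
  · exact absurd h1.symm h2
  · exact absurd h2.symm h1
  · simp

theorem coords_eq {U : K⟦X⟧} (hq : 1 ≤ q) (j : ℕ) : coords q (X + X ^ (q + 1) * U) j = coeff j U := by
  have h1 : q + j + 1 ≠ 1 := by omega
  have h2 : q + j + 1 - (q + 1) = j := by omega
  rw [coords, map_add, coeff_X, if_neg h1, zero_add, coeff_X_pow_mul', if_pos (by omega), h2]

variable {p : ℕ} [Fact p.Prime]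

theorem isWeightedHomogeneous_genericityPolynomial :
    MvPolynomial.IsWeightedHomogeneous (fun j : Fin (q + 1) => q + (j : ℕ))
      (genericityPolynomial p q) (q * (q + 1)) := by
  refine MvPolynomial.IsWeightedHomogeneous.add ?_ (MvPolynomial.IsWeightedHomogeneous.sum _ _ _ ?_)
  · convert (MvPolynomial.isWeightedHomogeneous_C _ _).mul
      ((MvPolynomial.isWeightedHomogeneous_X (ZMod p) _ (0 : Fin (q + 1))).pow (q + 1)) using 1
    simp
    ring
  · intro ι hι
    rw [Finset.mem_filter, Finset.mem_piAntidiag] at hι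
    convert (MvPolynomial.isWeightedHomogeneous_C _ _).mul
      (MvPolynomial.IsWeightedHomogeneous.prod Finset.univ _ _ fun j _ =>
        (MvPolynomial.isWeightedHomogeneous_X (ZMod p) _ j).pow (ι j)) using 1
    have h1 : ∑ j : Fin (q + 1), ι j • (q + (j : ℕ)) =
        q * ∑ j, ι j + ∑ j : Fin (q + 1), (j : ℕ) * ι j := by
      rw [Finset.mul_sum, ← Finset.sum_add_distrib]
      exact Finset.sum_congr rfl fun j _ => by rw [smul_eq_mul]; ring
    rw [h1, hι.1.1, hι.2]
    ring

variable [CharP K p]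

theorem genericityValue_eq (hq : 1 ≤ q) {U : K⟦X⟧} (hU : constantCoeff U ≠ 0) :
    genericityValue p q (X + X ^ (q + 1) * U) =
      constantCoeff U ^ (q + 1) * resit (X + X ^ (q + 1) * U) := by
  rw [resit_eq hU, mul_add, coeff_inv_eq_sum hU, genericityValue, genericityPolynomial]
  simp only [MvPolynomial.eval₂_add, MvPolynomial.eval₂_mul, MvPolynomial.eval₂_C,
    MvPolynomial.eval₂_sum, MvPolynomial.eval₂_prod, MvPolynomial.eval₂_pow, MvPolynomial.eval₂_X]
  simp only [coords_eq hq, map_div₀, map_mul, map_pow, map_neg, map_one, map_add, map_natCast, map_ofNat,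
    Fin.val_zero, coeff_zero_eq_constantCoeff]
  rw [add_comm, mul_comm ((q + 1 : K) / 2)]

end Polynomial

/-! ### Witnesses for nonvanishing and genericity. -/

section Generic

variable {K : Type*} [Field K] {p q : ℕ}

/-- Prescribing `U⁻¹` rather than `U` lets its coefficient of `X^q` be chosen freely. The resulting
point keeps genericity meaningful over finite fields. -/
theorem exists_mult_eq_resit_eq_one (K : Type*) [Field K] (hq : 1 ≤ q) :
    ∃ f : K⟦X⟧, mult f = ((q + 1 : ℕ) : ℕ∞) ∧ coords q f 0 = 1 ∧ resit f = 1 := by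
  have hq0 : q ≠ 0 := by omega
  set W : K⟦X⟧ := 1 + C (1 - (q + 1 : K) / 2) * X ^ q with hW
  have hW0 : constantCoeff W = 1 := by simp [hW, hq0]
  have hU : constantCoeff W⁻¹ = 1 := by rw [constantCoeff_inv, hW0, inv_one]
  have hU0 : constantCoeff W⁻¹ ≠ 0 := by rw [hU]; exact one_ne_zero
  have hinv : W⁻¹⁻¹ = W :=
    ((PowerSeries.eq_inv_iff_mul_eq_one hU0).2
      (PowerSeries.mul_inv_cancel W (by rw [hW0]; exact one_ne_zero))).symm
  refine ⟨X + X ^ (q + 1) * W⁻¹, mult_eq_natCast_iff.2 ⟨_, rfl, hU0⟩, ?_, ?_⟩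
  · rw [coords_eq hq, coeff_zero_eq_constantCoeff, hU]
  · rw [resit_eq hU0, hinv, hW, map_add, coeff_one, if_neg hq0, coeff_C_mul, coeff_X_pow_self]
    ring

theorem mult_eq_of_coords_ne_zero (hq : 1 ≤ q) {f : K⟦X⟧} (hf : f ∈ nottingham K q)
    (h0 : coords q f 0 ≠ 0) : mult f = ((q + 1 : ℕ) : ℕ∞) := by
  obtain ⟨U, hU⟩ := natCast_le_mult_iff.1 hf
  have hU := sub_eq_iff_eq_add'.1 hU
  refine mult_eq_natCast_iff.2 ⟨U, hU, ?_⟩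
  rwa [hU, coords_eq hq, coeff_zero_eq_constantCoeff] at h0

variable [Fact p.Prime] [CharP K p]

theorem pow_mul_resit_eq_genericityValue (hq : 1 ≤ q) {f : K⟦X⟧}
    (hf : mult f = ((q + 1 : ℕ) : ℕ∞)) :
    coords q f 0 ^ (q + 1) * resit f = genericityValue p q f := by
  obtain ⟨U, rfl, hU⟩ := mult_eq_natCast_iff.1 hf
  rw [genericityValue_eq hq hU, coords_eq hq, coeff_zero_eq_constantCoeff]

theorem genericityValue_ne_zero_iff (hq : 1 ≤ q) {f : K⟦X⟧} (hf : mult f = ((q + 1 : ℕ) : ℕ∞)) :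
    genericityValue p q f ≠ 0 ↔ resit f ≠ 0 := by
  obtain ⟨U, rfl, hU⟩ := mult_eq_natCast_iff.1 hf
  rw [genericityValue_eq hq hU, mul_ne_zero_iff, and_iff_right (pow_ne_zero _ hU)]

/-- The witness exists over `𝔽_p` itself, so `P` has a nonzero value there. -/
theorem genericityPolynomial_ne_zero (p : ℕ) [Fact p.Prime] (hq : 1 ≤ q) :
    genericityPolynomial p q ≠ 0 := by
  obtain ⟨f, hf, -, hr⟩ := exists_mult_eq_resit_eq_one (ZMod p) hq
  intro h0
  have h1 := (genericityValue_ne_zero_iff (p := p) hq hf).2 (by rw [hr]; exact one_ne_zero)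
  rw [genericityValue, h0, MvPolynomial.eval₂_zero] at h1
  exact h1 rfl

theorem exists_eval_coords_eq_genericityValue (K : Type*) [Field K] (p q : ℕ) [Fact p.Prime]
    [CharP K p] :
    ∃ Q : MvPolynomial ℕ K, ∀ f : K⟦X⟧, Q.eval (coords q f) = genericityValue p q f := by
  refine ⟨MvPolynomial.rename (fun j : Fin (q + 1) => (j : ℕ))
    ((genericityPolynomial p q).map (ZMod.castHom (dvd_refl p) K)), fun f => ?_⟩
  rw [MvPolynomial.eval_rename, MvPolynomial.eval_map]
  rfl

end Generic
end WildSeries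

/-! ### Assembly of the four assertions. -/

theorem mainTheorem4 (p : ℕ) [Fact p.Prime] (hp : Odd p) (K : Type*) [Field K] [CharP K p]
    (q : ℕ) (hq1 : 1 ≤ q) (hqp : q ≤ p - 1) :
    -- the explicit polynomial over `𝔽_p` is nonzero and isobaric of degree `q (q + 1)`
    WildSeries.genericityPolynomial p q ≠ 0 ∧
    MvPolynomial.IsWeightedHomogeneous (fun j : Fin (q + 1) => q + (j : ℕ))
      (WildSeries.genericityPolynomial p q) (q * (q + 1)) ∧
    -- series with a fixed point of multiplicity `q + 1` at the origin
    (∀ f : PowerSeries K, WildSeries.mult f = ((q + 1 : ℕ) : ℕ∞) →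
      WildSeries.coords q f 0 ^ (q + 1) * WildSeries.resit f = WildSeries.genericityValue p q f ∧
      (WildSeries.IsQRamified p q f ↔ WildSeries.genericityValue p q f ≠ 0) ∧
      (WildSeries.IsQRamified p q f ↔ WildSeries.resit f ≠ 0)) ∧
    WildSeries.IsGeneric q {f : PowerSeries K | WildSeries.mult f = ((q + 1 : ℕ) : ℕ∞)}
      {f | WildSeries.IsQRamified p q f} ∧
    -- the group `N_q(K)`
    (∀ f ∈ WildSeries.nottingham K q,
      (WildSeries.IsQRamified p q f ↔
        WildSeries.mult f = ((q + 1 : ℕ) : ℕ∞) ∧ WildSeries.resit f ≠ 0)) ∧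
    WildSeries.IsGeneric q (WildSeries.nottingham K q) {f | WildSeries.IsQRamified p q f} := by
  have hp2 : 2 ≤ p := (Fact.out : p.Prime).two_le
  have hp3 : 3 ≤ p := by
    obtain ⟨k, hk⟩ := hp
    omega
  have hlt : q < p := by omega
  have hram : ∀ f : PowerSeries K, WildSeries.mult f = ((q + 1 : ℕ) : ℕ∞) →
      (WildSeries.IsQRamified p q f ↔ WildSeries.resit f ≠ 0) :=
    fun f hf => WildSeries.isQRamified_iff_resit_ne_zero hp3 hq1 hlt hf
  have hval : ∀ f : PowerSeries K, WildSeries.mult f = ((q + 1 : ℕ) : ℕ∞) →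
      (WildSeries.genericityValue p q f ≠ 0 ↔ WildSeries.resit f ≠ 0) :=
    fun f hf => WildSeries.genericityValue_ne_zero_iff hq1 hf
  obtain ⟨Q, hQ⟩ := WildSeries.exists_eval_coords_eq_genericityValue K p q
  obtain ⟨g, hg, hg0, hgr⟩ := WildSeries.exists_mult_eq_resit_eq_one K hq1
  have hgQ : Q.eval (WildSeries.coords q g) ≠ 0 := by
    rw [hQ, hval g hg, hgr]
    exact one_ne_zero
  have hQ0 : Q ≠ 0 := by
    rintro rfl
    simp at hgQ
  refine ⟨WildSeries.genericityPolynomial_ne_zero p hq1,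
    WildSeries.isWeightedHomogeneous_genericityPolynomial, fun f hf => ?_, ?_, fun f _ => ?_, ?_⟩
  · exact ⟨WildSeries.pow_mul_resit_eq_genericityValue hq1 hf,
      (hram f hf).trans (hval f hf).symm, hram f hf⟩
  · refine ⟨Q, hQ0, ⟨g, hg, hgQ⟩, fun f hf hfQ => ?_⟩
    rw [hQ, hval f hf] at hfQ
    exact (hram f hf).2 hfQ
  · exact ⟨fun h => ⟨h.mult_eq hq1, (hram f (h.mult_eq hq1)).1 h⟩, fun h => (hram f h.1).2 h.2⟩
  -- The factor `X 0` forces multiplicity exactly `q + 1`, where the criterion by `Q` applies.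
  · refine ⟨MvPolynomial.X 0 * Q, mul_ne_zero (MvPolynomial.X_ne_zero 0) hQ0,
      ⟨g, hg.ge, ?_⟩, fun f hf hfQ => ?_⟩
    · rw [map_mul, MvPolynomial.eval_X, hg0, one_mul]
      exact hgQ
    · rw [map_mul, MvPolynomial.eval_X, mul_ne_zero_iff, hQ] at hfQ
      have hm := WildSeries.mult_eq_of_coords_ne_zero hq1 hf hfQ.1
      exact (hram f hm).2 ((hval f hm).1 hfQ.2)
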